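/- Conventions. Let $I=[0,1]$; maps are continuous and all mapping spaces carry the compact-open topology (subspaces the subspace topology). For a space $X$ and $x,y\in X$, let $\mathcal{P}X$ be the space of paths $I\to X$, $(\mathcal{P}X)_x$ the subspace of paths starting at $x$, $\mathcal{P}X(x,y)$ the subspace of paths from $x$ to $y$, and $(\Phi X)_x$ the space of maps $\Delta_2=\{(s,t)\in I^2: s+t\le 1\}\to X$ that send the edge $\{s=0\}$ to $x$. *Semicoverings.* A map $p\colon Y\to X$ is a semicovering if it is a local homeomorphism and, for every $y\in Y$, the maps $(\mathcal{P}Y)_y\to(\mathcal{P}X)_{p(y)}$ and $(\Phi Y)_y\to(\Phi X)_{p(y)}$ given by composition with $p$ are homeomorphisms. $\mathbf{SCov}(X)$ is the category whose objects are the semicoverings of $X$ and whose morphisms from $p\colon Y\to X$ to $p'\colon Y'\to X$ are the maps $f\colon Y\to Y'$ with $p'f=p$. *Locally wep-connected spaces.* A path $\alpha$ in $X$ is well-ended if for every open neighborhood $U$ of $\alpha$ in $\mathcal{P}X$ there are open neighborhoods $V_0$ of $\alpha(0)$ and $V_1$ of $\alpha(1)$ such that for all $a\in V_0$, $b\in V_1$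 there is a path $\beta\in U$ from $a$ to $b$; it is locally well-ended if, in addition, these $\beta$ can always be chosen well-ended. $X$ is locally wep-connected if any two points of $X$ are joined by a locally well-ended path. *$\mathbf{Top}$-groupoids.* A $\mathbf{qTop}$-groupoid is a small groupoid with a topology on its object set and on each hom-set such that composition is continuous in each variable separately and each inversion map $\mathcal{G}(x,y)\to\mathcal{G}(y,x)$ is continuous (no condition is put on the topology of the object set). It is a $\mathbf{Top}$-groupoid if composition is moreover jointly continuous. A morphism of $\mathbf{qTop}$-groupoids (of $\mathbf{Top}$-groupoids: a $\mathbf{Top}$-functor) is a functor that is continuous on each hom-set. The inclusion of $\mathbf{Top}$-groupoids into $\mathbf{qTop}$-groupoids has a left adjoint $\tau$ that is the identity on underlying groupoids: $\tau(\mathcal{G})$ carries the finest topologies on the hom-sets that are coarser than those of $\mathcal{G}$ and make it a $\mathbf{Top}$-groupoid. The fundamental $\mathbf{Top}$-groupoid of $X$ is $\pi^\tau X=\tau(\pi^{qtop}X)$, where $\pi^{qtop}X$ is the fundamental groupoid $\pi X$ with each hom-set $\pi X(x,y)$ given the quotient topology of $\mathcal{P}X(x,y)$. It is functorial in $X$;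 write $\pi^\tau f$ for the $\mathbf{Top}$-functor induced by a map $f$. *Open covering morphisms.* For a $\mathbf{Top}$-groupoid $\mathcal{G}$, an open covering morphism of $\mathcal{G}$ is a $\mathbf{Top}$-functor $F\colon\mathcal{H}\to\mathcal{G}$ of $\mathbf{Top}$-groupoids such that for each object $x$ of $\mathcal{H}$, $F$ is a bijection from the arrows of $\mathcal{H}$ with source $x$ to the arrows of $\mathcal{G}$ with source $F(x)$, and such that each map $\mathcal{H}(x,y)\to\mathcal{G}(F(x),F(y))$ is open. $\mathbf{OCovMor}(\mathcal{G})$ is the category of open covering morphisms of $\mathcal{G}$, a morphism from $F\colon\mathcal{H}\to\mathcal{G}$ to $F'\colon\mathcal{H}'\to\mathcal{G}$ being a $\mathbf{Top}$-functor $K\colon\mathcal{H}\to\mathcal{H}'$ with $F'K=F$. **Theorem.** Let $X$ be a locally wep-connected space. For every semicovering $p\colon Y\to X$, the $\mathbf{Top}$-functor $\pi^\tau p\colon\pi^\tau Y\to\pi^\tau X$ is an open covering morphism, and the resulting functor $$\pi^\tau_!\colon\mathbf{SCov}(X)\to\mathbf{OCovMor}(\pi^\tau X),\qquad p\mapsto\pi^\tau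 p,\quad f\mapsto\pi^\tau f,$$ is an equivalence of categories. -/

import Mathlib

open CategoryTheory
open scoped unitInterval Topology

universe u

namespace Semicov

/-! ## Semicovering maps -/

section Lifting

variable {X Y : Type*} [TopologicalSpace X] [TopologicalSpace Y]

/-- The space `(𝒫X)_x` of paths `I → X` starting at `x`, as a subspace of `C(I, X)` with the
compact-open topology. -/
abbrev PathsFrom (x : X) : Type _ := {α : C(I, X) // α 0 = x}

/-- The map `(𝒫Y)_y → (𝒫X)_{p(y)}`, `α ↦ p ∘ α`. -/
def PathsFrom.map (p : C(Y, X)) (y : Y) (α : PathsFrom y) : PathsFrom (p y) :=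
  ⟨p.comp α.1, congrArg p α.2⟩

/-- The triangle `Δ₂ = {(s, t) ∈ I² | s + t ≤ 1}`. -/
abbrev Triangle : Type := {z : I × I // (z.1 : ℝ) + (z.2 : ℝ) ≤ 1}

/-- The space `(ΦX)_x` of maps `Δ₂ → X` sending the edge `e₁` from `(0, 0)` to `(0, 1)`
(opposite to the vertex `(1, 0)`) to `x`, with the compact-open topology. -/
abbrev HomotopiesFrom (x : X) : Type _ := {φ : C(Triangle, X) // ∀ z : Triangle, z.1.1 = 0 → φ z = x}

/-- The map `(ΦY)_y → (ΦX)_{p(y)}`, `φ ↦ p ∘ φ`. -/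
def HomotopiesFrom.map (p : C(Y, X)) (y : Y) (φ : HomotopiesFrom y) : HomotopiesFrom (p y) :=
  ⟨p.comp φ.1, fun z hz => congrArg p (φ.2 z hz)⟩

/-- Continuous lifting of paths. -/
def HasContinuousPathLifting (p : C(Y, X)) : Prop :=
  ∀ y : Y, IsHomeomorph (PathsFrom.map p y)

/-- Continuous lifting of homotopies. -/
def HasContinuousHomotopyLifting (p : C(Y, X)) : Prop :=
  ∀ y : Y, IsHomeomorph (HomotopiesFrom.map p y)

/-- A semicovering map is a local homeomorphism with continuous lifting of paths and homotopies. -/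
structure IsSemicovering (p : C(Y, X)) : Prop where
  isLocalHomeomorph : IsLocalHomeomorph p
  pathLifting : HasContinuousPathLifting p
  homotopyLifting : HasContinuousHomotopyLifting p

end Lifting

/-- Those spaces over `X` whose structure map is a semicovering. -/
def isSemicoveringOver (X : TopCat.{u}) : ObjectProperty (Over X) :=
  fun p => IsSemicovering p.hom.hom

/-- The category of semicoverings of `X`: a morphism from `p : Y ⟶ X` to `p' : Y' ⟶ X` is a
continuous map `f : Y ⟶ Y'` with `f ≫ p' = p`. -/
abbrev SCov (X : TopCat.{u}) : Type (u + 1) := (isSemicoveringOver X).FullSubcategory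

/-! ## Locally wep-connected spaces -/

section Wep

variable {X : Type*} [TopologicalSpace X]

/-- Well-ended paths. -/
def WellEnded (α : C(I, X)) : Prop :=
  ∀ U : Set C(I, X), IsOpen U → α ∈ U →
    ∃ V₀ V₁ : Set X, IsOpen V₀ ∧ IsOpen V₁ ∧ α 0 ∈ V₀ ∧ α 1 ∈ V₁ ∧
      ∀ a ∈ V₀, ∀ b ∈ V₁, ∃ β ∈ U, β 0 = a ∧ β 1 = b

/-- Locally well-ended paths. -/
def LocallyWellEnded (α : C(I, X)) : Prop :=
  ∀ U : Set C(I, X), IsOpen U → α ∈ U →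
    ∃ V₀ V₁ : Set X, IsOpen V₀ ∧ IsOpen V₁ ∧ α 0 ∈ V₀ ∧ α 1 ∈ V₁ ∧
      ∀ a ∈ V₀, ∀ b ∈ V₁, ∃ β ∈ U, WellEnded β ∧ β 0 = a ∧ β 1 = b

/-- A space is locally wep-connected if any two points are joined by a locally well-ended path. -/
def LocallyWepConnected (X : Type*) [TopologicalSpace X] : Prop :=
  ∀ x y : X, ∃ α : C(I, X), LocallyWellEnded α ∧ α 0 = x ∧ α 1 = y

end Wep

/-! ## `qTop`-groupoids and `Top`-groupoids -/

/-- A family of topologies on the hom-sets of a groupoid makes it a `qTop`-groupoid if composition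
is continuous in each variable and inversion is continuous. -/
structure IsQTop {C : Type*} [Groupoid C] (T : ∀ x y : C, TopologicalSpace (x ⟶ y)) : Prop where
  continuous_comp_left : ∀ {x y : C} (z : C) (f : x ⟶ y),
    Continuous[T y z, T x z] fun g => f ≫ g
  continuous_comp_right : ∀ (x : C) {y z : C} (g : y ⟶ z),
    Continuous[T x y, T x z] fun f => f ≫ g
  continuous_inv : ∀ x y : C, Continuous[T x y, T y x] fun f => Groupoid.inv f

/-- Joint continuity of all composition maps. -/
def JointlyContinuousComp {C : Type*} [Groupoid C] (T : ∀ x y : C, TopologicalSpace (x ⟶ y)) :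
    Prop :=
  ∀ x y z : C, Continuous[@instTopologicalSpaceProd _ _ (T x y) (T y z), T x z]
    fun q : (x ⟶ y) × (y ⟶ z) => q.1 ≫ q.2

/-- A small `qTop`-groupoid. The object set carries a topology too; nothing is required of it, and
morphisms need not respect it. -/
structure QTopGrpd : Type (u + 1) where
  obj : Type u
  [groupoid : Groupoid.{u} obj]
  [objTop : TopologicalSpace obj]
  homTop : ∀ x y : obj, TopologicalSpace (x ⟶ y)
  isQTop : IsQTop homTop

namespace QTopGrpd

instance : CoeSort QTopGrpd.{u} (Type u) := ⟨QTopGrpd.obj⟩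

attribute [instance] QTopGrpd.groupoid QTopGrpd.objTop QTopGrpd.homTop

/-- A morphism of `qTop`-groupoids is a functor which is continuous on each hom-space. -/
@[ext]
structure Hom (G H : QTopGrpd.{u}) : Type u where
  functor : G ⥤ H
  continuous_map : ∀ x y : G, Continuous fun f : x ⟶ y => functor.map f

instance : Category QTopGrpd.{u} where
  Hom := Hom
  id G := ⟨𝟭 G, fun _ _ => continuous_id⟩
  comp F K := ⟨F.functor ⋙ K.functor, fun x y =>
    (K.continuous_map _ _).comp (F.continuous_map x y)⟩

end QTopGrpd

/-- Those `qTop`-groupoids whose composition maps are jointly continuous. -/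
def isTopGroupoid : ObjectProperty QTopGrpd.{u} := fun G => JointlyContinuousComp G.homTop

/-- The category of (small) `Top`-groupoids and `Top`-functors. -/
abbrev TopGrpd : Type (u + 1) := isTopGroupoid.{u}.FullSubcategory

/-! ## The functor `τ` -/

section Tau

variable {C : Type*} [Groupoid C]

/-- The families of topologies making `C` a `Top`-groupoid and coarser than `S`. -/
def CoarserTopGroupoidTopology (S : ∀ x y : C, TopologicalSpace (x ⟶ y)) : Type _ :=
  {T : ∀ x y : C, TopologicalSpace (x ⟶ y) //
    IsQTop T ∧ JointlyContinuousComp T ∧ ∀ x y, S x y ≤ T x y}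

/-- The finest family of topologies which makes `C` a `Top`-groupoid and is coarser than `S`
(in the order on topologies, `t ≤ t'` means that `t` is finer than `t'`). -/
@[reducible]
def tauTopology (S : ∀ x y : C, TopologicalSpace (x ⟶ y)) (x y : C) : TopologicalSpace (x ⟶ y) :=
  ⨅ T : CoarserTopGroupoidTopology S, T.1 x y

variable (S : ∀ x y : C, TopologicalSpace (x ⟶ y))

lemma le_tauTopology (x y : C) : S x y ≤ tauTopology S x y :=
  le_iInf fun T => T.2.2.2 x y

lemma tauTopology_isQTop : IsQTop (tauTopology S) where
  continuous_comp_left z f := continuous_iInf_rng.2 fun T =>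
    continuous_iInf_dom (i := T) (T.2.1.continuous_comp_left z f)
  continuous_comp_right x _ _ g := continuous_iInf_rng.2 fun T =>
    continuous_iInf_dom (i := T) (T.2.1.continuous_comp_right x g)
  continuous_inv x y := continuous_iInf_rng.2 fun T =>
    continuous_iInf_dom (i := T) (T.2.1.continuous_inv x y)

lemma tauTopology_jointlyContinuousComp : JointlyContinuousComp (tauTopology S) := by
  intro x y z
  refine continuous_iInf_rng.2 fun T => ?_
  refine continuous_le_dom ?_ (T.2.2.1 x y z)
  exact inf_le_inf (induced_mono (iInf_le _ T)) (induced_mono (iInf_le _ T))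

/-- The universal property of `tauTopology`: a functor to a `Top`-groupoid which is continuous for
`S` is continuous for `tauTopology S`. -/
lemma tauTopology_universal {D : Type*} [Groupoid D] {T : ∀ x y : D, TopologicalSpace (x ⟶ y)}
    (hT : IsQTop T) (hT' : JointlyContinuousComp T) (F : C ⥤ D)
    (hF : ∀ x y : C, Continuous[S x y, T (F.obj x) (F.obj y)] fun f => F.map f) (x y : C) :
    Continuous[tauTopology S x y, T (F.obj x) (F.obj y)] fun f => F.map f := by
  let T' : ∀ a b : C, TopologicalSpace (a ⟶ b) := fun a b =>
    TopologicalSpace.induced (fun f => F.map f) (T (F.obj a) (F.obj b))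
  have hc : ∀ a b : C, Continuous[T' a b, T (F.obj a) (F.obj b)] fun f => F.map f :=
    fun a b => continuous_induced_dom
  have h1 : IsQTop T' := by
    refine ⟨fun {a b} c f => ?_, fun a {b c} g => ?_, fun a b => ?_⟩
    · refine continuous_induced_rng.2 ?_
      have := @Continuous.comp _ _ _ (T' b c) (T _ _) (T _ _) _ _
        (hT.continuous_comp_left (F.obj c) (F.map f)) (hc b c)
      simpa [Function.comp_def] using this
    · refine continuous_induced_rng.2 ?_
      have := @Continuous.comp _ _ _ (T' a b) (T _ _) (T _ _) _ _
        (hT.continuous_comp_right (F.obj a) (F.map g)) (hc a b)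
      simpa [Function.comp_def] using this
    · refine continuous_induced_rng.2 ?_
      have := @Continuous.comp _ _ _ (T' a b) (T _ _) (T _ _) _ _
        (hT.continuous_inv (F.obj a) (F.obj b)) (hc a b)
      simpa [Function.comp_def] using this
  have h2 : JointlyContinuousComp T' := by
    intro a b c
    refine continuous_induced_rng.2 ?_
    have h3 : @Continuous _ _ (@instTopologicalSpaceProd _ _ (T' a b) (T' b c))
        (@instTopologicalSpaceProd _ _ (T (F.obj a) (F.obj b)) (T (F.obj b) (F.obj c)))
        (fun q : (a ⟶ b) × (b ⟶ c) => (F.map q.1, F.map q.2)) :=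
      @Continuous.prodMap _ _ _ _ (T (F.obj a) (F.obj b)) (T (F.obj b) (F.obj c)) (T' a b) (T' b c)
        _ _ (hc a b) (hc b c)
    have := @Continuous.comp _ _ _ (@instTopologicalSpaceProd _ _ (T' a b) (T' b c))
      (@instTopologicalSpaceProd _ _ (T (F.obj a) (F.obj b)) (T (F.obj b) (F.obj c)))
      (T (F.obj a) (F.obj c)) _ _ (hT' (F.obj a) (F.obj b) (F.obj c)) h3
    simpa [Function.comp_def] using this
  let T₀ : CoarserTopGroupoidTopology S :=
    ⟨T', h1, h2, fun a b => continuous_iff_le_induced.1 (hF a b)⟩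
  exact continuous_iInf_dom (i := T₀) (hc x y)

end Tau

/-- The functor `τ` from `qTop`-groupoids to `Top`-groupoids, which is the identity on underlying
groupoids. -/
def tau : QTopGrpd.{u} ⥤ TopGrpd.{u} where
  obj G :=
    { obj :=
        { obj := G.obj
          groupoid := G.groupoid
          objTop := G.objTop
          homTop := tauTopology G.homTop
          isQTop := tauTopology_isQTop G.homTop }
      property := tauTopology_jointlyContinuousComp G.homTop }
  map {G H} F := ObjectProperty.homMk
    { functor := F.functor
      continuous_map := tauTopology_universal G.homTop (tauTopology_isQTop H.homTop)
        (tauTopology_jointlyContinuousComp H.homTop) F.functor fun x y =>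
          continuous_le_rng (le_tauTopology H.homTop _ _) (F.continuous_map x y) }

/-- `τ` is left adjoint to the inclusion of `Top`-groupoids into `qTop`-groupoids. -/
def tauAdjunction : tau.{u} ⊣ isTopGroupoid.{u}.ι :=
  Adjunction.mkOfHomEquiv
    { homEquiv := fun G H =>
        { toFun := fun F => ⟨F.hom.functor, fun x y =>
            continuous_le_dom (le_tauTopology G.homTop x y) (F.hom.continuous_map x y)⟩
          invFun := fun F => ObjectProperty.homMk ⟨F.functor,
            tauTopology_universal G.homTop H.obj.isQTop H.property F.functor F.continuous_map⟩
          left_inv := fun _ => rfl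
          right_inv := fun _ => rfl }
      homEquiv_naturality_left_symm := fun _ _ => rfl
      homEquiv_naturality_right := fun _ _ => rfl }

/-! ## The fundamental `Top`-groupoid -/

section Fundamental

variable {X : Type*} [TopologicalSpace X]

/-- The quotient topology on `πX(x, y)` with respect to the map `𝒫X(x, y) → πX(x, y)`, `α ↦ [α]`,
where the space `𝒫X(x, y)` of paths from `x` to `y` has the compact-open topology. -/
@[reducible]
def qtopTopology (x y : FundamentalGroupoid X) : TopologicalSpace (x ⟶ y) :=
  TopologicalSpace.coinduced
    (Path.Homotopic.Quotient.mk : Path x.as y.as → Path.Homotopic.Quotient x.as y.as) inferInstance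

lemma continuous_qtop_iff {x y : FundamentalGroupoid X} {Z : Type*} {t : TopologicalSpace Z}
    {F : (x ⟶ y) → Z} : Continuous[qtopTopology x y, t] F ↔
      Continuous fun α : Path x.as y.as => F (Path.Homotopic.Quotient.mk α) :=
  continuous_coinduced_dom

lemma continuous_qtop_mk {x y : FundamentalGroupoid X} {W : Type*} [TopologicalSpace W]
    {g : W → Path x.as y.as} (hg : Continuous g) :
    Continuous[inferInstance, qtopTopology x y] fun w => Path.Homotopic.Quotient.mk (g w) :=
  @Continuous.comp _ _ _ _ _ (qtopTopology x y) _ _ continuous_coinduced_rng hg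

lemma qtopTopology_isQTop : IsQTop (qtopTopology (X := X)) where
  continuous_comp_left {x y} z f := by
    induction f using Path.Homotopic.Quotient.ind with | mk α =>
    refine continuous_qtop_iff.2 ?_
    exact continuous_qtop_mk (g := fun β : Path y.as z.as => α.trans β)
      (Path.continuous_trans.comp (Continuous.prodMk_right α))
  continuous_comp_right x {y z} g := by
    induction g using Path.Homotopic.Quotient.ind with | mk β =>
    refine continuous_qtop_iff.2 ?_
    exact continuous_qtop_mk (g := fun α : Path x.as y.as => α.trans β)
      (Path.continuous_trans.comp (Continuous.prodMk_left β))
  continuous_inv x y := by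
    refine continuous_qtop_iff.2 ?_
    exact continuous_qtop_mk (g := fun α : Path x.as y.as => α.symm) Path.continuous_symm

lemma continuous_path_map {Y : Type*} [TopologicalSpace Y] (f : C(X, Y)) (x y : X) :
    Continuous fun α : Path x y => α.map f.continuous :=
  Path.continuous_uncurry_iff.1 (f.continuous.comp
    (continuous_eval : Continuous fun q : Path x y × I => q.1 q.2))

end Fundamental

/-- The functor `π^qtop` taking a space to its fundamental groupoid, each hom-set being a quotient
of a space of paths. -/
noncomputable def piQTop : TopCat.{u} ⥤ QTopGrpd.{u} where
  obj X :=
    { obj := FundamentalGroupoid X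
      objTop := TopologicalSpace.induced FundamentalGroupoid.as inferInstance
      homTop := qtopTopology
      isQTop := qtopTopology_isQTop }
  map f :=
    { functor := FundamentalGroupoid.map f.hom
      continuous_map := fun x y => continuous_qtop_iff.2
        (continuous_qtop_mk (g := fun α : Path x.as y.as => α.map f.hom.continuous)
          (continuous_path_map f.hom x.as y.as)) }
  map_id _ := QTopGrpd.Hom.ext FundamentalGroupoid.map_id
  map_comp f g := QTopGrpd.Hom.ext (FundamentalGroupoid.map_comp g.hom f.hom)

/-- The functor `π^τ` taking a space to its fundamental `Top`-groupoid. -/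
noncomputable def piTau : TopCat.{u} ⥤ TopGrpd.{u} := piQTop ⋙ tau

/-! ## Open covering morphisms -/

/-- A `Top`-functor is a covering morphism if it is bijective on the set of arrows starting at each
object. -/
def IsCoveringMorphism {H G : TopGrpd.{u}} (F : H ⟶ G) : Prop :=
  ∀ x : H.obj, Function.Bijective (F.hom.functor.toPrefunctor.star x)

/-- A `Top`-functor is open if it is an open map on each hom-space. -/
def IsOpenTopFunctor {H G : TopGrpd.{u}} (F : H ⟶ G) : Prop :=
  ∀ x y : H.obj, IsOpenMap fun f : x ⟶ y => F.hom.functor.map f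

/-- Those `Top`-groupoids over `G` whose structure functor is an open covering morphism. -/
def isOpenCoveringOver (G : TopGrpd.{u}) : ObjectProperty (Over G) :=
  fun F => IsCoveringMorphism F.hom ∧ IsOpenTopFunctor F.hom

/-- The category of open covering morphisms of `G`: a morphism from `F : H ⟶ G` to `F' : H' ⟶ G`
is a `Top`-functor `K : H ⟶ H'` with `K ≫ F' = F`. -/
abbrev OCovMor (G : TopGrpd.{u}) : Type (u + 1) := (isOpenCoveringOver G).FullSubcategory

/-- The functor taking a semicovering `p : Y ⟶ X` to the `Top`-functor `π^τ p : π^τ Y ⟶ π^τ X`, as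
an object over `π^τ X`, and a morphism `f` of semicoverings to `π^τ f`. -/
noncomputable def piTauOver (X : TopCat.{u}) : SCov X ⥤ Over (piTau.obj X) :=
  (isSemicoveringOver X).ι ⋙ Over.post piTau

end Semicov

namespace Semicov

/-! A semicovering lifts paths uniquely and continuously, and a homotopy relative to the endpoints
is a path of paths, so it lifts too; hence the induced functor is bijective on stars. It is open for
the quotient topologies, because a lift ends at a prescribed point as soon as it ends in a
neighbourhood on which `p` is injective and lies over the right point. Openness survives `τ`
(`isOpenMap_tauTopology`): images of `τ`-open sets generate a groupoid topology on the base coarser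
than the quotient one.

A functor over `π X` between fundamental groupoids of semicoverings is determined by its map on
objects. Local wep-connectedness makes this map continuous (`continuous_of_compatible_lifts`), since
the points near a given one are endpoints of lifts of paths near a fixed path.

Conversely, an open covering functor `H → π X` transports objects of `H` along paths of `X`, and its
openness says that transporting `y` to `z` is an open condition on paths with fixed endpoints. With
the final topology for the endpoint maps on the objects, local wep-connectedness makes the
projection a local homeomorphism (`exists_isOpen_injOn`), and a path is lifted by transport along
its initial segments. Homotopy lifting follows from path lifting. The fundamental groupoid of this
semicovering and `H` have the same arrows in `π X`; both projections are faithful and open, so the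
two are isomorphic as `Top`-groupoids. -/

lemma faithful_of_injective_star {C D : Type*} [Category C] [Category D] {F : C ⥤ D}
    (hF : ∀ x, Function.Injective (F.toPrefunctor.star x)) : F.Faithful where
  map_injective {x y} f g h := by
    have := hF x (a₁ := ⟨y, f⟩) (a₂ := ⟨y, g⟩) (congrArg (Sigma.mk _) h)
    exact eq_of_heq (Sigma.ext_iff.1 this).2

/-! ## Unique lifting of paths and homotopies -/

section PathLifting

variable {X Y : Type*} [TopologicalSpace X] [TopologicalSpace Y] {p : C(Y, X)}

namespace HasContinuousPathLifting

lemma lift_unique (hp : HasContinuousPathLifting p) {α β : C(I, Y)} (h0 : α 0 = β 0)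
    (h : p.comp α = p.comp β) : α = β := by
  have : (⟨α, h0⟩ : PathsFrom (β 0)) = ⟨β, rfl⟩ := (hp (β 0)).bijective.1 (Subtype.ext h)
  exact congrArg Subtype.val this

/-- The lift of a path, depending continuously on the path. -/
noncomputable def lift (hp : HasContinuousPathLifting p) (y : Y) : C(PathsFrom (p y), PathsFrom y) :=
  ⟨((hp y).homeomorph _).symm, ((hp y).homeomorph _).symm.continuous⟩

lemma comp_lift (hp : HasContinuousPathLifting p) (y : Y) (α : PathsFrom (p y)) :
    p.comp (hp.lift y α).1 = α.1 :=
  congrArg Subtype.val (((hp y).homeomorph _).apply_symm_apply α)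

lemma lift_comp (hp : HasContinuousPathLifting p) {y : Y} (α : PathsFrom y) :
    hp.lift y (PathsFrom.map p y α) = α :=
  ((hp y).homeomorph _).symm_apply_apply α

lemma exists_lift (hp : HasContinuousPathLifting p) {y : Y} {α : C(I, X)} (h : α 0 = p y) :
    ∃ β : C(I, Y), β 0 = y ∧ p.comp β = α :=
  ⟨(hp.lift y ⟨α, h⟩).1, (hp.lift y ⟨α, h⟩).2, hp.comp_lift y ⟨α, h⟩⟩

/-- Homotopies of paths relative to the endpoints lift. -/
lemma homotopicRel_of_comp (hp : HasContinuousPathLifting p) {α β : C(I, Y)} (h0 : α 0 = β 0)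
    (h : (p.comp α).HomotopicRel (p.comp β) {0, 1}) : α.HomotopicRel β {0, 1} := by
  obtain ⟨H⟩ := h
  have hH0 : ∀ t, H (t, 0) = p (α 0) := fun t => H.eq_fst t (by simp)
  have hH1 : ∀ t, H (t, 1) = p (α 1) := fun t => H.eq_fst t (by simp)
  -- Currying turns the homotopy into a path of paths with a fixed start, so continuous lifting
  -- lifts all stages at once.
  let G : C(I, PathsFrom (p (α 0))) :=
    ⟨fun t => ⟨(H : C(I × I, X)).curry t, hH0 t⟩, ((H : C(I × I, X)).curry.continuous).subtype_mk _⟩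
  let L : C(I, C(I, Y)) := ⟨fun t => (hp.lift (α 0) (G t)).1,
    continuous_subtype_val.comp ((hp.lift (α 0)).continuous.comp G.continuous)⟩
  have hL : ∀ t, p.comp (L t) = (H : C(I × I, X)).curry t := fun t => hp.comp_lift (α 0) (G t)
  have hL0 : ∀ t, L t 0 = α 0 := fun t => (hp.lift (α 0) (G t)).2
  have hzero : L 0 = α := hp.lift_unique (hL0 0) <| by
    rw [hL]; ext s; exact H.apply_zero s
  have hone : L 1 = β := hp.lift_unique ((hL0 1).trans h0) <| by
    rw [hL]; ext s; exact H.apply_one s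
  -- The endpoints of the lifted stages trace a lift of a constant path, hence do not move.
  let E : C(I, Y) := ⟨fun t => L t 1, by fun_prop⟩
  have hE : E = ContinuousMap.const I (α 1) := hp.lift_unique (by simp [E, hzero]) <| by
    ext t
    exact (DFunLike.congr_fun (hL t) 1).trans (hH1 t)
  refine ⟨⟨⟨⟨fun z => L z.1 z.2, by fun_prop⟩, fun s => ?_, fun s => ?_⟩, fun t s hs => ?_⟩⟩
  · exact DFunLike.congr_fun hzero s
  · exact DFunLike.congr_fun hone s
  · rcases hs with rfl | rfl
    · exact hL0 t
    · exact DFunLike.congr_fun hE t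

end HasContinuousPathLifting

lemma homotopicRel_apply_one {α β : C(I, X)} (h : α.HomotopicRel β {0, 1}) : α 1 = β 1 := by
  obtain ⟨H⟩ := h
  exact (H.eq_fst 1 (x := 1) (by simp)).symm.trans (H.apply_one 1)

lemma homotopicRel_of_heq {a b a' b' : X} (α : Path a b) (β : Path a' b') (ha : a = a')
    (hb : b = b') (h : HEq (Path.Homotopic.Quotient.mk α) (Path.Homotopic.Quotient.mk β)) :
    (α : C(I, X)).HomotopicRel (β : C(I, X)) {0, 1} := by
  subst ha hb
  exact Path.Homotopic.Quotient.exact (eq_of_heq h)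

/-- Surjectivity is path lifting. For injectivity, the lifted homotopy fixes endpoints, which forces
the targets to agree before the classes can be compared. -/
lemma HasContinuousPathLifting.bijective_star (hp : HasContinuousPathLifting p)
    (y : FundamentalGroupoid Y) :
    Function.Bijective ((FundamentalGroupoid.map p).toPrefunctor.star y) := by
  constructor
  · rintro ⟨⟨z⟩, f⟩ ⟨⟨z'⟩, f'⟩ h
    induction f using Path.Homotopic.Quotient.ind with | mk α =>
    induction f' using Path.Homotopic.Quotient.ind with | mk β =>
    rw [Sigma.ext_iff] at h
    have hb : p z = p z' := congrArg FundamentalGroupoid.as h.1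
    have := hp.homotopicRel_of_comp (α := α) (β := β) (by simp)
      (homotopicRel_of_heq (α.map p.continuous) (β.map p.continuous) rfl hb h.2)
    have hz : z = z' := by simpa using homotopicRel_apply_one this
    subst hz
    exact congrArg _ (Path.Homotopic.Quotient.eq.2 this)
  · rintro ⟨⟨b⟩, f⟩
    induction f using Path.Homotopic.Quotient.ind with | mk α =>
    obtain ⟨β, h0, hβ⟩ := hp.exists_lift (y := y.as) (α := α) (by simp)
    have hb : p (β 1) = b := (DFunLike.congr_fun hβ 1).trans α.target
    subst hb
    refine ⟨⟨⟨β 1⟩, Path.Homotopic.Quotient.mk ⟨β, h0, rfl⟩⟩, ?_⟩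
    refine congrArg (Sigma.mk _) (congrArg Path.Homotopic.Quotient.mk ?_)
    ext t
    exact DFunLike.congr_fun hβ t

lemma HasContinuousPathLifting.faithful (hp : HasContinuousPathLifting p) :
    (FundamentalGroupoid.map p).Faithful :=
  faithful_of_injective_star fun y => (hp.bijective_star y).1

/-- The lift of a path ending at `p z` ends over `p z`, so it ends at `z` as soon as it ends in a
neighbourhood `N` of `z` on which `p` is injective. The closed condition on the endpoint thus
becomes an open one. -/
lemma IsSemicovering.isOpenMap_path_map (hp : IsSemicovering p) (y z : Y) :
    IsOpenMap fun α : Path y z => α.map p.continuous := by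
  intro O hO
  obtain ⟨O', hO', rfl⟩ := isOpen_induced_iff.1 hO
  obtain ⟨N, hN, hzN, hinj⟩ := hp.isLocalHomeomorph.isLocallyInjective z
  let L : Path (p y) (p z) → C(I, Y) := fun α => (hp.pathLifting.lift y ⟨α, α.source⟩).1
  have hL : Continuous L := continuous_subtype_val.comp <|
    (hp.pathLifting.lift y).continuous.comp <| continuous_induced_dom.subtype_mk _
  have hL0 : ∀ α, L α 0 = y := fun α => (hp.pathLifting.lift y ⟨α, α.source⟩).2
  have hpL : ∀ α, p.comp (L α) = α := fun α => hp.pathLifting.comp_lift y ⟨α, α.source⟩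
  convert (hO'.preimage hL).inter (hN.preimage ((continuous_eval_const (1 : I)).comp hL)) using 1
  ext α
  constructor
  · rintro ⟨γ, hγ, rfl⟩
    have : L (γ.map p.continuous) = γ := hp.pathLifting.lift_unique (by simp [hL0]) (hpL _)
    refine ⟨?_, ?_⟩
    · change L _ ∈ O'
      rw [this]; exact hγ
    · change L _ 1 ∈ N
      rw [this]; simpa using hzN
  · rintro ⟨h1, h2⟩
    have h3 : L α 1 = z := hinj h2 hzN ((DFunLike.congr_fun (hpL α) 1).trans α.target)
    refine ⟨⟨L α, hL0 α, h3⟩, h1, ?_⟩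
    ext t
    exact DFunLike.congr_fun (hpL α) t

/-- Homotopy lifting shows that the paths representing the image of `V` are exactly the images of
the paths representing `V`, which reduces the claim to path spaces. -/
lemma IsSemicovering.isOpenMap_qtop (hp : IsSemicovering p) (y z : FundamentalGroupoid Y) :
    @IsOpenMap _ _ (qtopTopology y z) (qtopTopology ((FundamentalGroupoid.map p).obj y)
      ((FundamentalGroupoid.map p).obj z)) fun f => (FundamentalGroupoid.map p).map f := by
  intro V hV
  have hV' : IsOpen (Path.Homotopic.Quotient.mk ⁻¹' V : Set (Path y.as z.as)) :=
    isOpen_coinduced.1 hV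
  refine isOpen_coinduced.2 ?_
  refine (congrArg (@IsOpen (Path (p y.as) (p z.as)) _) ?_).mpr
    (hp.isOpenMap_path_map y.as z.as _ hV')
  ext α
  constructor
  · rintro ⟨f, hf, h⟩
    induction f using Path.Homotopic.Quotient.ind with | mk β =>
    obtain ⟨γ, h0, hγ⟩ := hp.pathLifting.exists_lift (y := y.as) (α := α) α.source
    have hr : γ.HomotopicRel (β : C(I, Y)) {0, 1} :=
      hp.pathLifting.homotopicRel_of_comp (by simp [h0]) (by
        rw [hγ]; exact Path.Homotopic.Quotient.exact h.symm)
    have h1 : γ 1 = z.as := (homotopicRel_apply_one hr).trans β.target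
    refine ⟨⟨γ, h0, h1⟩, ?_, ?_⟩
    · have : Path.Homotopic.Quotient.mk (⟨γ, h0, h1⟩ : Path y.as z.as) = .mk β :=
        Path.Homotopic.Quotient.eq.2 hr
      rw [Set.mem_preimage, this]
      exact hf
    · ext t
      exact DFunLike.congr_fun hγ t
  · rintro ⟨β, hβ, rfl⟩
    exact ⟨_, hβ, rfl⟩

end PathLifting

/-! ## Covering functors and `τ` -/

section TauOpen

variable {C D : Type*} [Groupoid C] [Groupoid D] (F : D ⥤ C)

/-- Images of open sets of arrows under a functor. -/
inductive IsImageOfOpen (T : ∀ x y : D, TopologicalSpace (x ⟶ y)) :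
    ∀ {a b : C}, Set (a ⟶ b) → Prop
  | mk {y z : D} (V : Set (y ⟶ z)) (hV : IsOpen[T y z] V) :
      IsImageOfOpen T ((fun f => F.map f) '' V)

/-- The topologies on hom-sets generated by the images of open sets under a functor. -/
@[reducible]
def imageTopology (T : ∀ x y : D, TopologicalSpace (x ⟶ y)) (a b : C) : TopologicalSpace (a ⟶ b) :=
  TopologicalSpace.generateFrom {W | IsImageOfOpen F T W}

variable {F}

/-- If `f ≫ g` is the image of `v`, lift `f` to an arrow `k` with the same source as `v`; then `g`
is the image of `k⁻¹ ≫ v`. Joint continuity upstairs at this factorization of `v` gives two open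
sets whose images are the required neighbourhoods. -/
lemma imageTopology_jointlyContinuousComp
    (hF : ∀ x, Function.Surjective (F.toPrefunctor.star x))
    {T : ∀ x y : D, TopologicalSpace (x ⟶ y)} (hT : JointlyContinuousComp T) :
    JointlyContinuousComp (imageTopology F T) := by
  intro a m c
  let _ : ∀ x y : D, TopologicalSpace (x ⟶ y) := T
  let _ : ∀ x y : C, TopologicalSpace (x ⟶ y) := imageTopology F T
  refine continuous_generateFrom_iff.2 ?_
  rintro _ (@⟨y, z, V, hV⟩)
  refine isOpen_iff_mem_nhds.2 ?_
  rintro ⟨f, g⟩ ⟨v, hv, hvfg⟩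
  obtain ⟨⟨y', k⟩, hk⟩ := hF y ⟨m, f⟩
  obtain rfl : F.obj y' = m := congrArg Sigma.fst hk
  obtain rfl : F.map k = f := eq_of_heq (Sigma.ext_iff.1 hk).2
  have hg : F.map (Groupoid.inv k ≫ v) = g := by
    simp only [Functor.map_comp] at hvfg ⊢
    rw [hvfg]
    simp
  have hopen := hV.preimage (hT y y' z)
  obtain ⟨N₁, N₂, hN₁, hN₂, hk₁, hl₂, hsub⟩ :=
    isOpen_prod_iff.1 hopen k (Groupoid.inv k ≫ v) (by simpa using hv)
  have h1 : IsOpen ((fun f : y ⟶ y' => F.map f) '' N₁) :=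
    TopologicalSpace.isOpen_generateFrom_of_mem ⟨N₁, hN₁⟩
  have h2 : IsOpen ((fun f : y' ⟶ z => F.map f) '' N₂) :=
    TopologicalSpace.isOpen_generateFrom_of_mem ⟨N₂, hN₂⟩
  refine Filter.mem_of_superset ((h1.prod h2).mem_nhds ⟨⟨k, hk₁, rfl⟩, ⟨_, hl₂, hg⟩⟩) ?_
  rintro ⟨_, _⟩ ⟨⟨k', hk', rfl⟩, ⟨l', hl', rfl⟩⟩
  exact ⟨k' ≫ l', hsub (Set.mk_mem_prod hk' hl'), F.map_comp _ _⟩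

lemma JointlyContinuousComp.isQTop {T : ∀ x y : D, TopologicalSpace (x ⟶ y)}
    (hT : JointlyContinuousComp T)
    (hinv : ∀ x y : D, Continuous[T x y, T y x] fun f => Groupoid.inv f) : IsQTop T := by
  let _ : ∀ x y : D, TopologicalSpace (x ⟶ y) := T
  exact ⟨fun {x y} z f => (hT x y z).comp (Continuous.prodMk_right f),
    fun x {y z} g => (hT x y z).comp (Continuous.prodMk_left g), hinv⟩

lemma imageTopology_continuous_inv {T : ∀ x y : D, TopologicalSpace (x ⟶ y)} (hT : IsQTop T)
    (a b : C) : Continuous[imageTopology F T a b, imageTopology F T b a]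
      fun f => Groupoid.inv f := by
  refine continuous_generateFrom_iff.2 ?_
  rintro _ (@⟨y, z, V, hV⟩)
  refine TopologicalSpace.isOpen_generateFrom_of_mem ?_
  refine (congrArg (IsImageOfOpen F T) ?_).mpr (IsImageOfOpen.mk (F := F) (T := T)
    ((fun f : z ⟶ y => Groupoid.inv f) ⁻¹' V) (hV.preimage (hT.continuous_inv z y)))
  ext f
  constructor
  · rintro ⟨v, hv, h⟩
    refine ⟨Groupoid.inv v, by simpa using hv, ?_⟩
    have h' : F.map v = Groupoid.inv f := h
    simp [Groupoid.inv_eq_inv] at h' ⊢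
    simp [h']
  · rintro ⟨v, hv, rfl⟩
    exact ⟨_, hv, by simp [Groupoid.inv_eq_inv]⟩

/-- `τ` preserves open covering functors. -/
lemma isOpenMap_tauTopology {S : ∀ x y : D, TopologicalSpace (x ⟶ y)}
    {S' : ∀ x y : C, TopologicalSpace (x ⟶ y)}
    (hF : ∀ x, Function.Bijective (F.toPrefunctor.star x))
    (hopen : ∀ x y, @IsOpenMap _ _ (S x y) (S' (F.obj x) (F.obj y)) fun f => F.map f) (x y : D) :
    @IsOpenMap _ _ (tauTopology S x y) (tauTopology S' (F.obj x) (F.obj y)) fun f => F.map f := by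
  have hj := imageTopology_jointlyContinuousComp (fun x => (hF x).2)
    (tauTopology_jointlyContinuousComp S)
  -- The image topology competes in the infimum defining `tauTopology S'`, so its open sets, among
  -- them all images of `τ`-open sets, are open there.
  let T₀ : CoarserTopGroupoidTopology S' := ⟨imageTopology F (tauTopology S),
    hj.isQTop (imageTopology_continuous_inv (tauTopology_isQTop S)), hj, fun a b => by
      refine le_generateFrom ?_
      rintro _ ⟨V, hV⟩
      exact hopen _ _ _ (le_tauTopology S _ _ _ hV)⟩
  intro V hV
  exact iInf_le (fun T : CoarserTopGroupoidTopology S' => T.1 (F.obj x) (F.obj y)) T₀ _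
    (TopologicalSpace.isOpen_generateFrom_of_mem ⟨V, hV⟩)

end TauOpen

lemma isOpenCoveringOver_piTauOver {X : TopCat.{u}} (p : SCov X) :
    isOpenCoveringOver (piTau.obj X) ((piTauOver X).obj p) :=
  ⟨fun y => p.property.pathLifting.bijective_star y,
    fun y z => isOpenMap_tauTopology p.property.pathLifting.bijective_star
      p.property.isOpenMap_qtop y z⟩

/-! ## `π^τ` is fully faithful on semicoverings -/

section FullyFaithful

variable {X Y Y' : Type*} [TopologicalSpace X] [TopologicalSpace Y] [TopologicalSpace Y']
  {p : C(Y, X)} {q : C(Y', X)}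

lemma HasContinuousPathLifting.exists_lift_of_target (hp : HasContinuousPathLifting p) {y : Y}
    {α : C(I, X)} (h : α 1 = p y) : ∃ β : C(I, Y), β 1 = y ∧ p.comp β = α := by
  obtain ⟨β, h0, hβ⟩ := hp.exists_lift (y := y) (α := (⟨α, rfl, rfl⟩ : Path (α 0) (α 1)).symm)
    (by simp [h])
  refine ⟨(⟨β, rfl, rfl⟩ : Path (β 0) (β 1)).symm, by simp [h0], ?_⟩
  ext t
  simpa using DFunLike.congr_fun hβ (σ t)

/-- A map of semicoverings of a locally wep-connected space which is compatible with lifting of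
paths is continuous. -/
lemma continuous_of_compatible_lifts (hX : LocallyWepConnected X) (hp : IsSemicovering p)
    (hq : IsSemicovering q) {f : Y → Y'} (hf : ∀ y, q (f y) = p y)
    (hlift : ∀ γ : C(I, Y), ∃ δ : C(I, Y'), δ 0 = f (γ 0) ∧ δ 1 = f (γ 1) ∧
      (q.comp δ).HomotopicRel (p.comp γ) {0, 1}) : Continuous f := by
  refine continuous_iff_continuousAt.2 fun y₀ => ?_
  obtain ⟨α, hα, hα0, hα1⟩ := hX (p y₀) (p y₀)
  -- The loop is lifted so as to end at `y₀`; its lift may start elsewhere, and transport is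
  -- measured from that start.
  obtain ⟨γ₀, rfl, rfl⟩ := hp.pathLifting.exists_lift_of_target hα1
  obtain ⟨N, hN, hyN, hinj⟩ := hp.isLocalHomeomorph.isLocallyInjective (γ₀ 1)
  let e : PathsFrom (p (γ₀ 0)) → Y := fun β => (hp.pathLifting.lift _ β).1 1
  have he : Continuous e := (continuous_eval_const (1 : I)).comp
    (continuous_subtype_val.comp (hp.pathLifting.lift _).continuous)
  let e' : PathsFrom (p (γ₀ 0)) → Y' := fun β =>
    (hq.pathLifting.lift (f (γ₀ 0)) ⟨β.1, β.2.trans (hf _).symm⟩).1 1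
  have he' : Continuous e' := (continuous_eval_const (1 : I)).comp
    (continuous_subtype_val.comp ((hq.pathLifting.lift _).continuous.comp
      (continuous_subtype_val.subtype_mk _)))
  have hpe : ∀ β, p (e β) = β.1 1 := fun β =>
    DFunLike.congr_fun (hp.pathLifting.comp_lift _ β) 1
  -- Compatibility with lifts: `f` carries endpoints of lifts in `Y` to endpoints of lifts in `Y'`,
  -- where continuity in the path is known.
  have hee' : ∀ β, e' β = f (e β) := by
    intro β
    obtain ⟨δ, h0, h1, hδ⟩ := hlift (hp.pathLifting.lift _ β).1
    refine Eq.trans (Eq.symm ?_) h1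
    refine homotopicRel_apply_one (hq.pathLifting.homotopicRel_of_comp ?_ ?_)
    · rw [h0, (hp.pathLifting.lift _ β).2, (hq.pathLifting.lift _ _).2]
    · rw [hq.pathLifting.comp_lift]
      rwa [hp.pathLifting.comp_lift] at hδ
  let c₀ : PathsFrom (p (γ₀ 0)) := ⟨p.comp γ₀, rfl⟩
  have hc₀ : e c₀ = γ₀ 1 := by
    have : (hp.pathLifting.lift _ c₀).1 = γ₀ :=
      hp.pathLifting.lift_unique (hp.pathLifting.lift _ c₀).2 (hp.pathLifting.comp_lift _ c₀)
    exact DFunLike.congr_fun this 1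
  refine (nhds_basis_opens _).tendsto_right_iff.2 ?_
  rintro W ⟨hyW, hW⟩
  obtain ⟨Ω, hΩ, hΩ'⟩ := isOpen_induced_iff.1 ((hN.preimage he).inter (hW.preimage he'))
  have hmem : ∀ β : PathsFrom (p (γ₀ 0)), β.1 ∈ Ω ↔ e β ∈ N ∧ e' β ∈ W := fun β =>
    Set.ext_iff.1 hΩ' β
  obtain ⟨V₀, V₁, hV₀, hV₁, h0, h1, hV⟩ := hα Ω hΩ ((hmem c₀).2
    ⟨by rwa [hc₀], by rwa [hee', hc₀]⟩)
  filter_upwards [hN.mem_nhds hyN, (hV₁.preimage p.continuous).mem_nhds h1] with z hzN hzV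
  -- The start is kept fixed and the end moved to `p z`; the lift of `β` ends in `N` over `p z`,
  -- hence at `z`.
  obtain ⟨β, hβΩ, -, hβ0, hβ1⟩ := hV _ h0 _ hzV
  obtain ⟨hβN, hβW⟩ := (hmem ⟨β, hβ0⟩).1 hβΩ
  rw [hee'] at hβW
  rwa [hinj hβN hzN ((hpe _).trans hβ1)] at hβW

lemma map_heq_of_eq {C D : Type*} [Category C] [Category D] {F G : C ⥤ D} (h : F = G) {x y : C}
    (f : x ⟶ y) : HEq (F.map f) (G.map f) := by
  subst h; rfl

/-- A functor between fundamental groupoids of semicoverings over the base is induced by a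
continuous map. -/
lemma exists_map_eq (hX : LocallyWepConnected X) (hp : IsSemicovering p) (hq : IsSemicovering q)
    (K : FundamentalGroupoid Y ⥤ FundamentalGroupoid Y')
    (hK : K ⋙ FundamentalGroupoid.map q = FundamentalGroupoid.map p) :
    ∃ f : C(Y, Y'), q.comp f = p ∧ FundamentalGroupoid.map f = K := by
  have hobj : ∀ y : Y, q (K.obj ⟨y⟩).as = p y := fun y =>
    congrArg FundamentalGroupoid.as (Functor.congr_obj hK ⟨y⟩)
  let f : C(Y, Y') := ⟨fun y => (K.obj ⟨y⟩).as, by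
    refine continuous_of_compatible_lifts hX hp hq hobj fun γ => ?_
    obtain ⟨δ, hδ⟩ := Path.Homotopic.Quotient.mk_surjective
      (K.map (X := ⟨γ 0⟩) (Y := ⟨γ 1⟩) (Path.Homotopic.Quotient.mk ⟨γ, rfl, rfl⟩))
    refine ⟨δ, by simp, by simp, ?_⟩
    refine homotopicRel_of_heq (δ.map q.continuous)
      ((⟨γ, rfl, rfl⟩ : Path (γ 0) (γ 1)).map p.continuous) (hobj _) (hobj _) ?_
    rw [Path.Homotopic.Quotient.mk_map, hδ]
    exact map_heq_of_eq hK _⟩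
  have hqf : q.comp f = p := ContinuousMap.ext hobj
  refine ⟨f, hqf, ?_⟩
  have hfK : FundamentalGroupoid.map f ⋙ FundamentalGroupoid.map q = K ⋙ FundamentalGroupoid.map q :=
    by rw [← FundamentalGroupoid.map_comp, hqf, hK]
  -- Agreement on objects holds by construction; on arrows it can be tested after the faithful
  -- projection to the base.
  have := hq.pathLifting.faithful
  refine CategoryTheory.Functor.hext (fun _ => rfl) fun y z g => heq_of_eq ?_
  refine (FundamentalGroupoid.map q).map_injective (eq_of_heq ?_)
  exact map_heq_of_eq hfK g

end FullyFaithful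

lemma piTauOver_full {X : TopCat.{u}} (hX : LocallyWepConnected X) : (piTauOver X).Full where
  map_surjective {P Q} K := by
    have hK : K.left.hom.functor ⋙ FundamentalGroupoid.map Q.obj.hom.hom =
        FundamentalGroupoid.map P.obj.hom.hom :=
      congrArg (fun F : piTau.obj P.obj.left ⟶ piTau.obj X => F.hom.functor) (Over.w K)
    obtain ⟨f, hf, hfK⟩ := exists_map_eq hX P.property Q.property K.left.hom.functor hK
    refine ⟨ObjectProperty.homMk (Over.homMk (TopCat.ofHom f) ?_), ?_⟩
    · exact TopCat.hom_ext hf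
    · refine Over.OverMorphism.ext (ObjectProperty.hom_ext _ (QTopGrpd.Hom.ext ?_))
      exact hfK

lemma piTauOver_faithful {X : TopCat.{u}} : (piTauOver X).Faithful where
  map_injective {P Q} f g h := by
    have h' : FundamentalGroupoid.map f.hom.left.hom = FundamentalGroupoid.map g.hom.left.hom :=
      congrArg (fun K => K.left.hom.functor) h
    refine ObjectProperty.hom_ext _ (Over.OverMorphism.ext (TopCat.hom_ext ?_))
    ext y
    exact congrArg FundamentalGroupoid.as (Functor.congr_obj h' ⟨y⟩)

/-! ## Continuous lifting of homotopies follows from continuous lifting of paths -/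

section HomotopyLifting

/-- For compact `K`, the closed set `f ⁻¹' K` is compact, and by surjectivity `g` maps `K` into `U`
exactly when `g ∘ f` maps `f ⁻¹' K` into `U`. -/
lemma isInducing_precomp_of_surjective {A B Z : Type*} [TopologicalSpace A] [TopologicalSpace B]
    [TopologicalSpace Z] [CompactSpace A] [T2Space B] (f : C(A, B)) (hf : Function.Surjective f) :
    Topology.IsInducing fun g : C(B, Z) => g.comp f := by
  refine ⟨le_antisymm (ContinuousMap.continuous_precomp f).le_induced ?_⟩
  rw [ContinuousMap.compactOpen_eq]
  refine le_generateFrom ?_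
  rintro _ ⟨K, hK, U, hU, rfl⟩
  refine isOpen_induced_iff.2 ⟨{g | Set.MapsTo g (f ⁻¹' K) U},
    ContinuousMap.isOpen_setOfPred_mapsTo (hK.isClosed.preimage f.continuous).isCompact hU, ?_⟩
  ext g
  refine ⟨fun h b hb => ?_, fun h a ha => h ha⟩
  obtain ⟨a, rfl⟩ := hf b
  exact h hb

/-- The quotient map from the square to the triangle collapsing the edge `t = 1`. -/
def squareToTriangle : C(I × I, Triangle) where
  toFun z := ⟨(z.1 * σ z.2, z.2), by
    have h1 := z.1.2.2
    have h2 := z.2.2.2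
    simp only [Set.Icc.coe_mul, unitInterval.coe_symm_eq]
    nlinarith⟩
  continuous_toFun := by fun_prop

lemma squareToTriangle_surjective : Function.Surjective squareToTriangle := by
  rintro ⟨⟨s, t⟩, h⟩
  by_cases ht : t = 1
  · subst ht
    have hs : s = 0 := by
      refine Subtype.ext (le_antisymm ?_ s.2.1)
      simpa using h
    subst hs
    exact ⟨(0, 1), by simp [squareToTriangle]⟩
  · have ht' : (0 : ℝ) < 1 - t := by
      have := lt_of_le_of_ne t.2.2 (fun e => ht (Subtype.ext e))
      linarith
    refine ⟨(⟨s / (1 - t), div_nonneg s.2.1 ht'.le, (div_le_one ht').2 ?_⟩, t), ?_⟩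
    · have : (s : ℝ) + t ≤ 1 := h
      linarith
    · refine Subtype.ext (Prod.ext (Subtype.ext ?_) rfl)
      simp [squareToTriangle, ht'.ne']

variable {X Y : Type*} [TopologicalSpace X] [TopologicalSpace Y] {p : C(Y, X)}

/-- The slice of a triangle as a path. -/
def HomotopiesFrom.slice {x : X} (φ : HomotopiesFrom x) (t : I) : PathsFrom x :=
  ⟨⟨fun u => φ.1 (squareToTriangle (u, t)), by fun_prop⟩,
    φ.2 _ (by simp [squareToTriangle])⟩

lemma HomotopiesFrom.continuous_slice {x : X} :
    Continuous fun z : HomotopiesFrom x × I => z.1.slice z.2 := by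
  refine Continuous.subtype_mk (ContinuousMap.continuous_of_continuous_uncurry _ ?_) _
  change Continuous fun z : (HomotopiesFrom x × I) × I => z.1.1.1 (squareToTriangle (z.2, z.1.2))
  exact ((ContinuousMap.continuous_precomp squareToTriangle).comp
    (continuous_subtype_val.comp (continuous_fst.comp continuous_fst))).eval
      (continuous_snd.prodMk (continuous_snd.comp continuous_fst))

/-- Horizontal slices of the triangle all start on the edge sent to the base point, so they lift as
a continuous family on the square. The slice at `t = 1` is constant, hence so is its lift, and the
family descends to the triangle. -/
lemma HasContinuousPathLifting.hasContinuousHomotopyLifting (hp : HasContinuousPathLifting p) :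
    HasContinuousHomotopyLifting p := by
  intro y
  have hq : Topology.IsQuotientMap squareToTriangle :=
    squareToTriangle.continuous.isClosedMap.isQuotientMap squareToTriangle.continuous
      squareToTriangle_surjective
  let L : HomotopiesFrom (p y) → I × I → Y := fun φ z => (hp.lift y (φ.slice z.2)).1 z.1
  have hL : Continuous fun z : HomotopiesFrom (p y) × (I × I) => L z.1 z.2 := by
    have h1 : Continuous fun z : HomotopiesFrom (p y) × (I × I) => hp.lift y (z.1.slice z.2.2) :=
      (hp.lift y).continuous.comp (HomotopiesFrom.continuous_slice.comp
        (continuous_fst.prodMk (continuous_snd.comp continuous_snd)))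
    exact (continuous_subtype_val.comp h1).eval (continuous_fst.comp continuous_snd)
  have hpL : ∀ φ z, p (L φ z) = φ.1 (squareToTriangle z) := fun φ z =>
    DFunLike.congr_fun (hp.comp_lift y (φ.slice z.2)) z.1
  have hL0 : ∀ φ t, L φ (0, t) = y := fun φ t => (hp.lift y (φ.slice t)).2
  have hL1 : ∀ φ u, L φ (u, 1) = y := by
    intro φ u
    have : (hp.lift y (φ.slice 1)).1 = ContinuousMap.const I y :=
      hp.lift_unique (hp.lift y (φ.slice 1)).2 <| by
        ext u
        refine (DFunLike.congr_fun (hp.comp_lift y (φ.slice 1)) u).trans ?_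
        exact φ.2 _ (by simp [squareToTriangle])
    exact DFunLike.congr_fun this u
  have hfib : ∀ φ z z', squareToTriangle z = squareToTriangle z' → L φ z = L φ z' := by
    rintro φ ⟨u, t⟩ ⟨u', t'⟩ h
    have h1 : t = t' := congrArg (fun w => w.1.2) h
    subst h1
    by_cases ht : t = 1
    · subst ht; rw [hL1, hL1]
    · have h2 : (u : ℝ) * (1 - t) = u' * (1 - t) := congrArg (fun w => (w.1.1 : ℝ)) h
      have h3 : (1 : ℝ) - t ≠ 0 := fun e => ht (Subtype.ext (sub_eq_zero.1 e).symm)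
      rw [Subtype.ext (mul_right_cancel₀ h3 h2)]
  let L' : HomotopiesFrom (p y) → C(I × I, Y) := fun φ => ⟨L φ, hL.comp (Continuous.prodMk_right φ)⟩
  let S : HomotopiesFrom (p y) → HomotopiesFrom y := fun φ =>
    ⟨hq.lift (L' φ) (fun z z' h => hfib φ z z' h), by
      intro z hz
      obtain ⟨t, rfl⟩ : ∃ t, squareToTriangle (0, t) = z :=
        ⟨z.1.2, Subtype.ext (Prod.ext (by simp [squareToTriangle, hz]) rfl)⟩
      exact (DFunLike.congr_fun (hq.lift_comp (L' φ) (fun z z' h => hfib φ z z' h)) (0, t)).trans (hL0 φ t)⟩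
  have hS : ∀ φ z, (S φ).1 (squareToTriangle z) = L φ z := fun φ z =>
    DFunLike.congr_fun (hq.lift_comp (L' φ) (fun z z' h => hfib φ z z' h)) z
  have hcont : Continuous (HomotopiesFrom.map p y) :=
    ((ContinuousMap.continuous_postcomp p).comp continuous_subtype_val).subtype_mk _
  refine isHomeomorph_iff_exists_inverse.2 ⟨hcont, S, fun φ => ?_, fun φ => ?_, ?_⟩
  · refine Subtype.ext (ContinuousMap.ext fun w => ?_)
    obtain ⟨⟨u, t⟩, rfl⟩ := squareToTriangle_surjective w
    rw [hS]
    have : (hp.lift y ((HomotopiesFrom.map p y φ).slice t)).1 = (φ.slice t).1 :=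
      congrArg Subtype.val (hp.lift_comp (φ.slice t))
    exact DFunLike.congr_fun this u
  · refine Subtype.ext (ContinuousMap.ext fun w => ?_)
    obtain ⟨z, rfl⟩ := squareToTriangle_surjective w
    exact (congrArg p (hS φ z)).trans (hpL φ z)
  · refine Continuous.subtype_mk ?_ _
    -- Continuity of the inverse is tested after pulling back to the square, where the lift is given
    -- by `L`.
    refine (isInducing_precomp_of_surjective squareToTriangle
      squareToTriangle_surjective).continuous_iff.2 ?_
    refine ContinuousMap.continuous_of_continuous_uncurry _ ?_
    refine hL.congr fun z => ?_
    exact (hS z.1 z.2).symm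

end HomotopyLifting

/-! ## Spaces built from transport along paths -/

/-- Transport along paths of `X` in the fibres of `p : Y → X`: the relation `R y z α` says that `α`
transports `y` to `z`. -/
structure IsPathTransport {X : Type*} [TopologicalSpace X] {Y : Type*} (p : Y → X)
    (R : Y → Y → C(I, X) → Prop) : Prop where
  source : ∀ {y z α}, R y z α → α 0 = p y
  target : ∀ {y z α}, R y z α → α 1 = p z
  exists_target : ∀ {y} {α : C(I, X)}, α 0 = p y → ∃ z, R y z α
  target_unique : ∀ {y z z' α}, R y z α → R y z' α → z = z'
  of_homotopicRel : ∀ {y z} {α β : C(I, X)}, R y z α → α.HomotopicRel β {0, 1} → R y z β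
  refl : ∀ y, R y y (ContinuousMap.const I (p y))
  symm : ∀ {y z} {a b : X} (α : Path a b), R y z α → R z y α.symm
  trans : ∀ {y z w} {a b c : X} (α : Path a b) (β : Path b c), R y z α → R z w β →
    R y w (α.trans β)
  isOpen : ∀ (a b : X) (y z : Y), IsOpen {α : Path a b | R y z α}

section Concatenation

variable {X : Type*} [TopologicalSpace X]

/-- A path followed by the reverse of a path with the same endpoint. -/
noncomputable def transSymm {a b : X} (q : {q : PathsFrom a × PathsFrom b // q.1.1 1 = q.2.1 1}) : Path a b :=
  (⟨q.1.1.1, q.1.1.2, rfl⟩ : Path a (q.1.1.1 1)).trans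
    (⟨q.1.2.1, q.1.2.2, q.2.symm⟩ : Path b (q.1.1.1 1)).symm

lemma continuous_transSymm {a b : X} : Continuous (transSymm (a := a) (b := b)) := by
  refine Path.continuous_uncurry_iff.1 (Path.trans_continuous_family
    (ι := {q : PathsFrom a × PathsFrom b // q.1.1 1 = q.2.1 1}) (a := fun _ => a)
    (b := fun q => q.1.1.1 1) (c := fun _ => b) _ ?_ _
    (Path.symm_continuous_family (a := fun _ => b) (b := fun q => q.1.1.1 1)
      (fun q : {q : PathsFrom a × PathsFrom b // q.1.1 1 = q.2.1 1} =>
        (⟨q.1.2.1, q.1.2.2, q.2.symm⟩ : Path b (q.1.1.1 1))) ?_))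
  · change Continuous fun z : {q : PathsFrom a × PathsFrom b // q.1.1 1 = q.2.1 1} × I =>
      z.1.1.1.1 z.2
    fun_prop
  · change Continuous fun z : {q : PathsFrom a × PathsFrom b // q.1.1 1 = q.2.1 1} × I =>
      z.1.1.2.1 z.2
    fun_prop

lemma homotopic_trans_symm_trans {a b c : X} (α : Path a c) (β : Path b c) :
    ((α.trans β.symm).trans β).Homotopic α := by
  rw [← Path.Homotopic.Quotient.eq]
  simp [Path.Homotopic.Quotient.mk_trans, Path.Homotopic.Quotient.mk_symm]

/-- The initial segments of a path. -/
def PathsFrom.initial {x : X} (α : PathsFrom x) (t : I) : PathsFrom x :=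
  ⟨⟨fun s => α.1 (t * s), by fun_prop⟩, by simpa using α.2⟩

lemma PathsFrom.continuous_initial {x : X} :
    Continuous fun z : PathsFrom x × I => z.1.initial z.2 := by
  refine Continuous.subtype_mk (ContinuousMap.continuous_of_continuous_uncurry _ ?_) _
  change Continuous fun z : (PathsFrom x × I) × I => z.1.1.1 (z.1.2 * z.2)
  fun_prop

end Concatenation

namespace IsPathTransport

variable {X : Type*} [TopologicalSpace X] {Y : Type*} {p : Y → X} {R : Y → Y → C(I, X) → Prop}

/-- The point to which a path transports `y`. -/
noncomputable def endpoint (h : IsPathTransport p R) (y : Y) (α : PathsFrom (p y)) : Y :=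
  (h.exists_target α.2).choose

lemma endpoint_spec (h : IsPathTransport p R) (y : Y) (α : PathsFrom (p y)) :
    R y (h.endpoint y α) α.1 :=
  (h.exists_target α.2).choose_spec

lemma endpoint_eq_iff (h : IsPathTransport p R) {y z : Y} {α : PathsFrom (p y)} :
    h.endpoint y α = z ↔ R y z α.1 :=
  ⟨fun e => e ▸ h.endpoint_spec y α, fun hz => h.target_unique (h.endpoint_spec y α) hz⟩

/-- The finest topology for which transport of each point is continuous in the path. -/
@[reducible]
noncomputable def topology (h : IsPathTransport p R) : TopologicalSpace Y :=
  ⨆ y, TopologicalSpace.coinduced (h.endpoint y) inferInstance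

/-- Transport along nearby paths with common endpoints. -/
lemma exists_nhds_transport (h : IsPathTransport p R) {y₁ y₂ z : Y} {β γ : C(I, X)}
    (hβ : R y₁ z β) (hγ : R y₂ z γ) :
    ∃ N₁ N₂ : Set C(I, X), IsOpen N₁ ∧ IsOpen N₂ ∧ β ∈ N₁ ∧ γ ∈ N₂ ∧
      ∀ β' ∈ N₁, ∀ γ' ∈ N₂, γ' 0 = p y₂ → β' 1 = γ' 1 → ∀ z', R y₁ z' β' → R y₂ z' γ' := by
  -- The path `β` followed by the reverse of `γ` transports `y₁` to `y₂`, and this is an open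
  -- condition on the pair.
  have hO := (h.isOpen (p y₁) (p y₂) y₁ y₂).preimage continuous_transSymm
  obtain ⟨O, hO, hO'⟩ := isOpen_induced_iff.1 hO
  have hiff : ∀ q, q.1 ∈ O ↔ R y₁ y₂ (transSymm q) := fun q => Set.ext_iff.1 hO' q
  have hβγ : β 1 = γ 1 := (h.target hβ).trans (h.target hγ).symm
  have hmem : ((⟨β, h.source hβ⟩, ⟨γ, h.source hγ⟩) : PathsFrom (p y₁) × PathsFrom (p y₂)) ∈ O :=
    (hiff ⟨(⟨β, h.source hβ⟩, ⟨γ, h.source hγ⟩), hβγ⟩).2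
      (h.trans _ _ hβ (h.symm (⟨γ, h.source hγ, hβγ.symm⟩ : Path (p y₂) (β 1)) hγ))
  obtain ⟨M₁, M₂, hM₁, hM₂, h1, h2, hsub⟩ := isOpen_prod_iff.1 hO _ _ hmem
  obtain ⟨N₁, hN₁, rfl⟩ := isOpen_induced_iff.1 hM₁
  obtain ⟨N₂, hN₂, rfl⟩ := isOpen_induced_iff.1 hM₂
  refine ⟨N₁, N₂, hN₁, hN₂, h1, h2, fun β' hβ' γ' hγ' h0 he z' hz' => ?_⟩
  have hR := (hiff ⟨(⟨β', h.source hz'⟩, ⟨γ', h0⟩), he⟩).1 (hsub (Set.mk_mem_prod hβ' hγ'))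
  obtain ⟨z'', hz''⟩ := h.exists_target h0
  -- Appending `γ'` cancels its reverse up to homotopy, so `β'` also transports `y₁` to `z''`.
  have h3 := h.trans _ (⟨γ', h0, he.symm⟩ : Path (p y₂) (β' 1)) hR hz''
  have h4 := h.of_homotopicRel h3 (homotopic_trans_symm_trans
    (⟨β', h.source hz', rfl⟩ : Path (p y₁) (β' 1)) (⟨γ', h0, he.symm⟩ : Path (p y₂) (β' 1)))
  rwa [h.target_unique hz' h4]

lemma exists_source (h : IsPathTransport p R) {z : Y} {α : C(I, X)} (hα : α 1 = p z) :
    ∃ y, R y z α := by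
  let P : Path (α 0) (p z) := ⟨α, rfl, hα⟩
  obtain ⟨y, hy⟩ := h.exists_target (y := z) (α := P.symm) P.symm.source
  have := h.symm _ hy
  rw [Path.symm_symm] at this
  exact ⟨y, this⟩

variable [t : TopologicalSpace Y]

lemma isOpen_iff (h : IsPathTransport p R) (ht : t = h.topology) {U : Set Y} :
    IsOpen U ↔ ∀ y, IsOpen (h.endpoint y ⁻¹' U) := by
  subst ht
  simp only [isOpen_iSup_iff, isOpen_coinduced]

lemma continuous_endpoint (h : IsPathTransport p R) (ht : t = h.topology) (y : Y) :
    Continuous (h.endpoint y) :=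
  continuous_def.2 fun _ hU => (h.isOpen_iff ht).1 hU y

lemma continuous_proj (h : IsPathTransport p R) (ht : t = h.topology) : Continuous p := by
  refine continuous_def.2 fun U hU => (h.isOpen_iff ht).2 fun y => ?_
  have : h.endpoint y ⁻¹' (p ⁻¹' U) = (fun α : PathsFrom (p y) => α.1 1) ⁻¹' U := by
    ext α
    simp [h.target (h.endpoint_spec y α)]
  rw [this]
  exact hU.preimage ((continuous_eval_const (1 : I)).comp continuous_subtype_val)

/-- A well-ended path near whose end every point is reached with the start unchanged gives, by
transport from `y`, points of `W` over a whole neighbourhood of `p z`. -/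
lemma isOpenMap_proj (h : IsPathTransport p R) (ht : t = h.topology) (hX : LocallyWepConnected X) :
    IsOpenMap p := by
  intro W hW
  refine isOpen_iff_mem_nhds.2 ?_
  rintro _ ⟨z, hz, rfl⟩
  obtain ⟨α, hα, -, hα1⟩ := hX (p z) (p z)
  obtain ⟨y, hy⟩ := h.exists_source hα1
  obtain ⟨Ω, hΩ, hΩ'⟩ := isOpen_induced_iff.1 ((h.isOpen_iff ht).1 hW y)
  have hmem : ∀ β : PathsFrom (p y), β.1 ∈ Ω ↔ h.endpoint y β ∈ W := fun β =>
    Set.ext_iff.1 hΩ' β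
  obtain ⟨V₀, V₁, hV₀, hV₁, h0, h1, hV⟩ := hα Ω hΩ
    ((hmem ⟨α, h.source hy⟩).2 (by rwa [h.endpoint_eq_iff.2 hy]))
  rw [hα1] at h1
  filter_upwards [hV₁.mem_nhds h1] with b hb
  obtain ⟨β, hβ, -, hβ0, hβ1⟩ := hV _ h0 b hb
  have hβ0' : β 0 = p y := hβ0.trans (h.source hy)
  exact ⟨_, (hmem ⟨β, hβ0'⟩).1 hβ, (h.target (h.endpoint_spec y ⟨β, hβ0'⟩)).symm.trans hβ1⟩

/-- The neighbourhood consists of transports of one point `y` along paths close to `α`. Two such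
paths with a common end transport `y` to the same point, whence injectivity. Openness is where local
well-endedness is needed. -/
lemma exists_isOpen_injOn (h : IsPathTransport p R) (ht : t = h.topology)
    (hX : LocallyWepConnected X) (z : Y) : ∃ N : Set Y, IsOpen N ∧ z ∈ N ∧ Set.InjOn p N := by
  obtain ⟨α, hα, -, hα1⟩ := hX (p z) (p z)
  obtain ⟨y, hy⟩ := h.exists_source hα1
  obtain ⟨N₁, N₂, hN₁, hN₂, hm₁, hm₂, hN⟩ := h.exists_nhds_transport hy hy
  obtain ⟨V₀, V₁, hV₀, hV₁, h0, h1, hV⟩ := hα (N₁ ∩ N₂) (hN₁.inter hN₂) ⟨hm₁, hm₂⟩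
  rw [h.source hy] at h0
  refine ⟨{w | p w ∈ V₁ ∧ ∃ β ∈ N₁ ∩ N₂, R y w β}, ?_, ?_, ?_⟩
  · refine (h.isOpen_iff ht).2 fun y₂ => isOpen_iff_mem_nhds.2 ?_
    rintro γ ⟨hγV, β₀, hβ₀, hyβ₀⟩
    change p _ ∈ V₁ at hγV
    -- `β₀` need not be well-ended, so it is replaced by a well-ended `β` with the same end, which
    -- transports `y` to the same point.
    obtain ⟨β, hβ, hβwe, hβ0, hβ1⟩ := hV _ h0 _ hγV
    obtain ⟨w, hw⟩ := h.exists_target hβ0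
    obtain rfl : w = h.endpoint y₂ γ := h.target_unique hw
      (hN β₀ hβ₀.1 β hβ.2 hβ0 ((h.target hyβ₀).trans hβ1.symm) _ hyβ₀)
    obtain ⟨M₁, M₂, hM₁, hM₂, hβM, hγM, hM⟩ :=
      h.exists_nhds_transport hw (h.endpoint_spec y₂ γ)
    obtain ⟨V₀', V₁', hV₀', hV₁', h0', h1', hV'⟩ :=
      hβwe (M₁ ∩ (N₁ ∩ N₂)) (hM₁.inter (hN₁.inter hN₂)) ⟨hβM, hβ⟩
    rw [hβ1, ← h.target (h.endpoint_spec y₂ γ)] at h1'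
    rw [← h.target (h.endpoint_spec y₂ γ)] at hγV
    have hev : Continuous fun γ' : PathsFrom (p y₂) => γ'.1 1 :=
      (continuous_eval_const (1 : I)).comp continuous_subtype_val
    filter_upwards [(hM₂.preimage continuous_subtype_val).mem_nhds hγM,
      (hV₁.preimage hev).mem_nhds hγV, (hV₁'.preimage hev).mem_nhds h1'] with γ' hγ'M hγ'V hγ'V'
    -- Moving the end of `β` along with that of `γ'` exhibits the endpoint of `γ'` as a transport of
    -- `y`.
    obtain ⟨β', hβ', hβ'0, hβ'1⟩ := hV' _ h0' _ hγ'V'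
    obtain ⟨w, hw'⟩ := h.exists_target (hβ'0.trans hβ0)
    have hw2 := hM β' hβ'.1 γ'.1 hγ'M γ'.2 hβ'1 w hw'
    refine ⟨?_, β', hβ'.2, ?_⟩
    · rw [← h.target (h.endpoint_spec y₂ γ')]
      exact hγ'V
    · rwa [h.endpoint_eq_iff.2 hw2]
  · exact ⟨hα1 ▸ h1, α, ⟨hm₁, hm₂⟩, hy⟩
  · rintro w ⟨-, β, hβ, hw⟩ w' ⟨-, β', hβ', hw'⟩ he
    refine h.target_unique (hN β hβ.1 β' hβ'.2 (h.source hw') ?_ w hw) hw'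
    rw [h.target hw, h.target hw', he]

lemma isLocalHomeomorph (h : IsPathTransport p R) (ht : t = h.topology)
    (hX : LocallyWepConnected X) : IsLocalHomeomorph p := by
  refine isLocalHomeomorph_iff_isOpenEmbedding_restrict.2 fun z => ?_
  obtain ⟨N, hN, hz, hinj⟩ := h.exists_isOpen_injOn ht hX z
  exact ⟨N, hN.mem_nhds hz, .of_continuous_injective_isOpenMap
    ((h.continuous_proj ht).comp continuous_subtype_val) hinj.injective
    ((h.isOpenMap_proj ht hX).comp hN.isOpenMap_subtype_val)⟩

/-- The image of a path in `Y` transports its start to its end. -/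
lemma transport_comp (h : IsPathTransport p R) (ht : t = h.topology)
    (hX : LocallyWepConnected X) (γ : C(I, Y)) (hp : Continuous p) :
    R (γ 0) (γ 1) ((⟨p, hp⟩ : C(Y, X)).comp γ) := by
  let P : Path (p (γ 0)) (p (γ 1)) := ⟨(⟨p, hp⟩ : C(Y, X)).comp γ, rfl, rfl⟩
  have hrefl : ∀ s, R (γ s) (γ s) (P.subpath s s) := by
    intro s
    rw [Path.subpath_self]
    exact h.refl (γ s)
  -- Near `s`, both `γ` and transport from `γ s` along `P` are continuous lifts of `P` into a set on
  -- which `p` is injective, so they agree.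
  have hloc : ∀ s : I, ∀ᶠ s' in 𝓝 s, R (γ s) (γ s') (P.subpath s s') := by
    intro s
    obtain ⟨N, hN, hsN, hinj⟩ := h.exists_isOpen_injOn ht hX (γ s)
    let δ : I → Y := fun s' => h.endpoint (γ s) ⟨P.subpath s s', (P.subpath s s').source⟩
    have hδ : Continuous δ := by
      refine (h.continuous_endpoint ht (γ s)).comp (Continuous.subtype_mk
        (ContinuousMap.continuous_of_continuous_uncurry _ ?_) _)
      exact P.subpath_continuous_family.comp (continuous_const.prodMk continuous_id)
    have hδs : δ s = γ s := h.endpoint_eq_iff.2 (hrefl s)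
    filter_upwards [(hN.preimage hδ).mem_nhds (hδs.symm ▸ hsN : δ s ∈ N),
      (hN.preimage γ.continuous).mem_nhds hsN] with s' h1 h2
    refine h.endpoint_eq_iff.1 (hinj h1 h2 ?_)
    exact (h.target (h.endpoint_spec _ _)).symm.trans (P.subpath s s').target
  have hmono : ∀ s s', R (γ s) (γ s') (P.subpath s s') → R (γ 0) (γ s) (P.subpath 0 s) →
      R (γ 0) (γ s') (P.subpath 0 s') := fun s s' h1 h2 =>
    h.of_homotopicRel (h.trans _ _ h2 h1) ⟨Path.Homotopy.subpathTransSubpath P 0 s s'⟩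
  have hconst : IsLocallyConstant fun s => R (γ 0) (γ s) (P.subpath 0 s) := by
    refine (IsLocallyConstant.iff_eventually_eq _).2 fun s => ?_
    filter_upwards [hloc s] with s' hs'
    exact propext ⟨hmono s' s (by simpa using h.symm _ hs'), hmono s s' hs'⟩
  have h1 : R (γ 0) (γ 1) (P.subpath 0 1) :=
    (hconst.apply_eq_of_preconnectedSpace 0 1).mp (hrefl 0)
  rw [Path.subpath_zero_one] at h1
  exact h1

/-- The lift at time `s` is the transport of `y` along the initial segment up to `s`. That this
recovers a given path in `Y` is `transport_comp` applied to its initial segments. -/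
lemma hasContinuousPathLifting (h : IsPathTransport p R) (ht : t = h.topology)
    (hX : LocallyWepConnected X) (hp : Continuous p) :
    HasContinuousPathLifting (⟨p, hp⟩ : C(Y, X)) := by
  intro y
  have hE : Continuous fun z : PathsFrom (p y) × I => h.endpoint y (z.1.initial z.2) :=
    (h.continuous_endpoint ht y).comp PathsFrom.continuous_initial
  let L : PathsFrom (p y) → PathsFrom y := fun α =>
    ⟨⟨fun s => h.endpoint y (α.initial s), hE.comp (Continuous.prodMk_right α)⟩, by
      refine h.endpoint_eq_iff.2 ?_
      convert h.refl y
      ext s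
      simpa [PathsFrom.initial] using α.2⟩
  refine isHomeomorph_iff_exists_inverse.2 ⟨?_, L, fun γ => ?_, fun α => ?_, ?_⟩
  · exact ((ContinuousMap.continuous_postcomp _).comp continuous_subtype_val).subtype_mk _
  · refine Subtype.ext (ContinuousMap.ext fun s => h.endpoint_eq_iff.2 ?_)
    have := h.transport_comp ht hX (γ.initial s).1 hp
    rw [(γ.initial s).2] at this
    have h1 : (γ.initial s).1 1 = γ.1 s := by simp [PathsFrom.initial]
    rwa [h1] at this
  · refine Subtype.ext (ContinuousMap.ext fun s => ?_)
    refine (h.target (h.endpoint_spec y (α.initial s))).symm.trans ?_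
    simp [PathsFrom.initial]
  · exact (ContinuousMap.continuous_of_continuous_uncurry _ hE).subtype_mk _

end IsPathTransport

/-! ## Covering functors over the fundamental groupoid -/

section Transport

variable {X : Type*} [TopologicalSpace X] {H : Type*} [Groupoid H] (Φ : H ⥤ FundamentalGroupoid X)

/-- Transport of objects along paths defined by a covering functor to the fundamental groupoid. -/
def FunctorTransport (y z : H) (α : C(I, X)) : Prop :=
  ∃ (h0 : α 0 = (Φ.obj y).as) (h1 : α 1 = (Φ.obj z).as) (k : y ⟶ z),
    Φ.map k = Path.Homotopic.Quotient.mk ⟨α, h0, h1⟩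

variable {Φ}

/-- Bijectivity on stars gives existence and uniqueness of targets. For the right endpoints, the
paths carrying `y` to `z` form the preimage of the image of a whole hom-set; otherwise there are
none. -/
lemma isPathTransport_functorTransport (hΦ : ∀ y, Function.Bijective (Φ.toPrefunctor.star y))
    (hopen : ∀ y z : H, IsOpen[qtopTopology (Φ.obj y) (Φ.obj z)]
      (Set.range fun k : y ⟶ z => Φ.map k)) :
    IsPathTransport (fun y => (Φ.obj y).as) (FunctorTransport Φ) where
  source := fun ⟨h0, _, _⟩ => h0
  target := fun ⟨_, h1, _⟩ => h1
  exists_target {y α} h0 := by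
    obtain ⟨⟨z, k⟩, hk⟩ := (hΦ y).2 ⟨⟨α 1⟩, Path.Homotopic.Quotient.mk ⟨α, h0, rfl⟩⟩
    have h1 : Φ.obj z = ⟨α 1⟩ := congrArg Sigma.fst hk
    refine ⟨z, h0, (congrArg FundamentalGroupoid.as h1).symm, k, ?_⟩
    refine eq_of_heq ((Sigma.ext_iff.1 hk).2.trans ?_)
    exact Path.Homotopic.hpath_hext fun _ => rfl
  target_unique {y z z' α} := by
    rintro ⟨h0, h1, k, hk⟩ ⟨h0', h1', k', hk'⟩
    have hz : Φ.obj z = Φ.obj z' := congrArg FundamentalGroupoid.mk (h1.symm.trans h1')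
    have := (hΦ y).1 (a₁ := ⟨z, k⟩) (a₂ := ⟨z', k'⟩) (Sigma.ext hz (by
      refine (heq_of_eq hk).trans (HEq.trans ?_ (heq_of_eq hk').symm)
      exact Path.Homotopic.hpath_hext fun _ => rfl))
    exact congrArg Sigma.fst this
  of_homotopicRel {y z α β} := by
    rintro ⟨h0, h1, k, hk⟩ h
    refine ⟨?_, (homotopicRel_apply_one h).symm.trans h1, k, hk.trans ?_⟩
    · obtain ⟨H⟩ := h
      exact ((H.eq_fst 1 (x := 0) (by simp)).symm.trans (H.apply_one 0)).symm.trans h0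
    · exact Path.Homotopic.Quotient.eq.2 h
  refl y := ⟨rfl, rfl, 𝟙 y, Φ.map_id y⟩
  symm {y z a b} α := by
    rintro ⟨h0, h1, k, hk⟩
    obtain rfl : a = _ := α.source.symm.trans h0
    obtain rfl : b = _ := α.target.symm.trans h1
    refine ⟨by simp, by simp, Groupoid.inv k, ?_⟩
    have : Φ.map (Groupoid.inv k) = Groupoid.inv (Φ.map k) := by simp [Groupoid.inv_eq_inv]
    rw [this, hk]
    rfl
  trans {y z w a b c} α β := by
    rintro ⟨h0, h1, k, hk⟩ ⟨h0', h1', k', hk'⟩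
    obtain rfl : a = _ := α.source.symm.trans h0
    obtain rfl : b = _ := α.target.symm.trans h1
    obtain rfl : c = _ := β.target.symm.trans h1'
    refine ⟨by simp, by simp, k ≫ k', ?_⟩
    rw [Φ.map_comp, hk, hk']
    rfl
  isOpen a b y z := by
    by_cases ha : a = (Φ.obj y).as
    · by_cases hb : b = (Φ.obj z).as
      · subst ha hb
        convert isOpen_coinduced.1 (hopen y z) using 1
        ext α
        exact ⟨fun ⟨_, _, k, hk⟩ => ⟨k, hk⟩, fun ⟨k, hk⟩ => ⟨α.source, α.target, k, hk⟩⟩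
      · convert isOpen_empty
        refine Set.eq_empty_iff_forall_notMem.2 ?_
        rintro α ⟨-, h1, -⟩
        exact hb (α.target.symm.trans h1)
    · convert isOpen_empty
      refine Set.eq_empty_iff_forall_notMem.2 ?_
      rintro α ⟨h0, -⟩
      exact ha (α.source.symm.trans h0)

/-- An open covering functor over the fundamental groupoid of a locally wep-connected space is the
fundamental groupoid of a semicovering. -/
lemma exists_semicovering_of_functor (hX : LocallyWepConnected X)
    (hΦ : ∀ y, Function.Bijective (Φ.toPrefunctor.star y))
    (hopen : ∀ y z : H, IsOpen[qtopTopology (Φ.obj y) (Φ.obj z)]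
      (Set.range fun k : y ⟶ z => Φ.map k)) :
    ∃ (_ : TopologicalSpace H) (hp : Continuous fun y => (Φ.obj y).as),
      IsSemicovering (⟨fun y => (Φ.obj y).as, hp⟩ : C(H, X)) ∧ ∀ y z : H,
        (∀ f : FundamentalGroupoid.mk y ⟶ FundamentalGroupoid.mk z, ∃ k : y ⟶ z,
          Φ.map k = (FundamentalGroupoid.map ⟨_, hp⟩).map f) ∧
        ∀ k : y ⟶ z, ∃ f : FundamentalGroupoid.mk y ⟶ FundamentalGroupoid.mk z,
          (FundamentalGroupoid.map ⟨_, hp⟩).map f = Φ.map k := by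
  have h := isPathTransport_functorTransport hΦ hopen
  let t : TopologicalSpace H := h.topology
  have hp : Continuous fun y => (Φ.obj y).as := h.continuous_proj rfl
  have hlift := h.hasContinuousPathLifting rfl hX hp
  have htr := fun γ : C(I, H) => h.transport_comp rfl hX γ hp
  refine ⟨t, hp, ⟨h.isLocalHomeomorph rfl hX, hlift, hlift.hasContinuousHomotopyLifting⟩,
    fun y z => ⟨fun f => ?_, fun k => ?_⟩⟩
  · induction f using Path.Homotopic.Quotient.ind with | mk γ =>
    have hγ := htr γ
    rw [show (γ : C(I, H)) 0 = y from γ.source, show (γ : C(I, H)) 1 = z from γ.target] at hγ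
    obtain ⟨_, _, k, hk⟩ := hγ
    exact ⟨k, hk⟩
  · obtain ⟨α, hα⟩ := Path.Homotopic.Quotient.mk_surjective (Φ.map k)
    have hyz : FunctorTransport Φ y z α := ⟨α.source, α.target, k, hα.symm⟩
    -- A representative of `Φ.map k` is lifted from `y`; uniqueness of transport forces its end to
    -- be `z`.
    obtain ⟨γ, rfl, hγ⟩ := hlift.exists_lift (y := y) (h.source hyz)
    have := htr γ
    rw [hγ] at this
    obtain rfl := h.target_unique this hyz
    refine ⟨Path.Homotopic.Quotient.mk ⟨γ, rfl, rfl⟩, Eq.trans ?_ hα⟩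
    refine congrArg Path.Homotopic.Quotient.mk (Path.ext ?_)
    exact funext fun s => DFunLike.congr_fun hγ s

end Transport

/-! ### Essential surjectivity -/

lemma continuous_of_comp_eq {A B Z : Type*} {tA : TopologicalSpace A} {tB : TopologicalSpace B}
    {tZ : TopologicalSpace Z} {i : B → Z} (hi : IsOpenMap i) (hinj : Function.Injective i)
    {g : A → Z} (hg : Continuous g) {f : A → B} (hf : ∀ a, i (f a) = g a) : Continuous f := by
  refine continuous_def.2 fun W hW => ?_
  convert (hi W hW).preimage hg using 1
  ext a
  simp [← hf, hinj.eq_iff]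

lemma piTauOver_essSurj {X : TopCat.{u}} (hX : LocallyWepConnected X) (F : OCovMor (piTau.obj X)) :
    ∃ P : SCov X, Nonempty ((piTauOver X).obj P ≅ F.obj) := by
  let H : TopGrpd.{u} := F.obj.left
  let Φ : H.obj.obj ⥤ FundamentalGroupoid X := F.obj.hom.hom.functor
  obtain ⟨hΦ, hopen⟩ : IsCoveringMorphism F.obj.hom ∧ IsOpenTopFunctor F.obj.hom := F.property
  obtain ⟨t, hp, hsc, hk⟩ := exists_semicovering_of_functor (Φ := Φ) hX hΦ fun y z => by
    -- Sets open for `τ` are open for the finer quotient topology, where path spaces can be used.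
    refine le_tauTopology (qtopTopology (X := X)) _ _ _ ?_
    rw [← Set.image_univ]
    exact hopen y z _ isOpen_univ
  let Y : TopCat.{u} := @TopCat.of H.obj.obj t
  let p : C(Y, X) := ⟨fun y => (Φ.obj y).as, hp⟩
  let P : SCov X := ⟨Over.mk (TopCat.ofHom p), hsc⟩
  have hfΦ : Φ.Faithful := faithful_of_injective_star fun x => (hΦ x).1
  have hfp : (FundamentalGroupoid.map p).Faithful := hsc.pathLifting.faithful
  obtain ⟨-, hPopen⟩ := isOpenCoveringOver_piTauOver P
  choose a ha using fun y z => (hk y z).1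
  choose b hb using fun y z => (hk y z).2
  let A : FundamentalGroupoid Y ⥤ H.obj.obj :=
    { obj := fun y => y.as
      map := fun {y z} f => a y.as z.as f
      map_id := fun y => Φ.map_injective <| by
        rw [ha, Φ.map_id]
        exact (FundamentalGroupoid.map p).map_id y
      map_comp := fun {x y z} f g => Φ.map_injective <| by
        rw [ha, Φ.map_comp, ha, ha]
        exact (FundamentalGroupoid.map p).map_comp f g }
  let B : H.obj.obj ⥤ FundamentalGroupoid Y :=
    { obj := fun y => ⟨y⟩
      map := fun {y z} k => b y z k
      map_id := fun y => (FundamentalGroupoid.map p).map_injective <| by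
        refine (hb y y _).trans ?_
        exact Φ.map_id y
      map_comp := fun {x y z} f g => (FundamentalGroupoid.map p).map_injective <| by
        refine (hb x z _).trans ?_
        rw [(FundamentalGroupoid.map p).map_comp]
        refine (Φ.map_comp f g).trans ?_
        exact congrArg₂ (· ≫ ·) (hb _ _ f).symm (hb _ _ g).symm }
  -- Each functor is continuous because the projection of its codomain is open and injective on
  -- hom-sets, and its composite with that projection is continuous.
  let A' : piTau.obj Y ⟶ H := ObjectProperty.homMk ⟨A, fun y z =>
    continuous_of_comp_eq (hopen y.as z.as) Φ.map_injective
      ((piTau.map (TopCat.ofHom p)).hom.continuous_map y z) (ha y.as z.as)⟩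
  let B' : H ⟶ piTau.obj Y := ObjectProperty.homMk ⟨B, fun y z =>
    continuous_of_comp_eq (hPopen ⟨y⟩ ⟨z⟩) (FundamentalGroupoid.map p).map_injective
      (F.obj.hom.hom.continuous_map y z) (hb y z)⟩
  let i : piTau.obj Y ≅ H :=
    { hom := A'
      inv := B'
      hom_inv_id := by
        refine ObjectProperty.hom_ext _ (QTopGrpd.Hom.ext ?_)
        refine CategoryTheory.Functor.hext (fun _ => rfl) fun y z f => heq_of_eq ?_
        refine (FundamentalGroupoid.map p).map_injective ?_
        exact (hb _ _ _).trans (ha _ _ f)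
      inv_hom_id := by
        refine ObjectProperty.hom_ext _ (QTopGrpd.Hom.ext ?_)
        refine CategoryTheory.Functor.hext (fun _ => rfl) fun y z f => heq_of_eq ?_
        refine Φ.map_injective ?_
        exact (ha _ _ _).trans (hb _ _ f) }
  refine ⟨P, ⟨Over.isoMk i ?_⟩⟩
  refine ObjectProperty.hom_ext _ (QTopGrpd.Hom.ext ?_)
  exact CategoryTheory.Functor.hext (fun _ => rfl) fun y z f => heq_of_eq (ha _ _ f)

end Semicov

theorem mainTheorem5 (X : TopCat.{u}) (hX : Semicov.LocallyWepConnected X) :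
    ∃ h : ∀ p : Semicov.SCov X,
        Semicov.isOpenCoveringOver (Semicov.piTau.obj X) ((Semicov.piTauOver X).obj p),
      ((Semicov.isOpenCoveringOver (Semicov.piTau.obj X)).lift
        (Semicov.piTauOver X) h : Semicov.SCov X ⥤ Semicov.OCovMor (Semicov.piTau.obj X)).IsEquivalence := by
  have := Semicov.piTauOver_full hX
  have := Semicov.piTauOver_faithful (X := X)
  refine ⟨Semicov.isOpenCoveringOver_piTauOver, inferInstance, inferInstance, ⟨fun F => ?_⟩⟩
  obtain ⟨P, ⟨i⟩⟩ := Semicov.piTauOver_essSurj hX F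
  exact ⟨P, ⟨ObjectProperty.isoMk _ i⟩⟩
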